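/- Throughout, an absolute neighborhood retract (ANR) is a metrizable space $\mathcal V$ such that every continuous map $\psi:\mathcal C\to\mathcal V$ from a closed subset $\mathcal C$ of a metrizable space $\mathcal Z$ extends continuously to some open set $\mathcal W$ with $\mathcal C\subset\mathcal W\subset\mathcal Z$; every ANR is moreover assumed to be finite-dimensional, in the sense that it admits a topological embedding into some $\mathbb R^m$. An ANR pair $(\mathcal U,\mathcal A)$ consists of an ANR $\mathcal U$ and a subspace $\mathcal A\subset\mathcal U$ that is itself an ANR. The mapping cylinder of a continuous map $f:\mathcal X\to\mathcal Y$ is the quotient space $$M(f)=\big((\mathcal X\times[0,1])\sqcup\mathcal Y\big)/\big((x,0)\sim f(x)\big),$$ and $\mathcal X$ is identified with the subspace $\mathcal X\times\{1\}$ of $M(f)$. A strong deformation retraction of a space $M$ onto a subset $S$ is a homotopy $\omega_t:M\to M$, $t\in[0,1]$, with $\omega_0=\mathrm{id}$, $\omega_1(M)\subset S$ and $\omega_t|_S=\mathrm{id}_S$ for all $t$. Let $(\mathcal U,\mathcal A)$ and $(\mathcal V,\mathcal B)$ be ANR pairs with $\mathcal A$ closed in $\mathcal U$ and $\mathcal B$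 closed in $\mathcal V$, and let $\gamma:\mathcal U\to\mathcal V$ be a continuous map with $\gamma(\mathcal A)\subset\mathcal B$ such that both $\gamma:\mathcal U\to\mathcal V$ and $\gamma|_{\mathcal A}:\mathcal A\to\mathcal B$ are homotopy equivalences. Then: 1. $\gamma:(\mathcal U,\mathcal A)\to(\mathcal V,\mathcal B)$ is a homotopy equivalence of pairs: there is a continuous map $\delta:\mathcal V\to\mathcal U$ with $\delta(\mathcal B)\subset\mathcal A$, a homotopy from $\delta\circ\gamma$ to $\mathrm{id}_{\mathcal U}$ each stage of which maps $\mathcal A$ into $\mathcal A$, and a homotopy from $\gamma\circ\delta$ to $\mathrm{id}_{\mathcal V}$ each stage of which maps $\mathcal B$ into $\mathcal B$. 2. Every strong deformation retraction $\omega_t$ of $M(\gamma|_{\mathcal A})$ onto $\mathcal A$ extends, after reparametrization, to a strong deformation retraction $\theta_t$ of $M(\gamma)$ onto $\mathcal U$: on $M(\gamma|_{\mathcal A})$ (mapped to $M(\gamma)$ by the map induced by the inclusions) one has $\theta_t=\omega_{\min(2t,1)}$ for all $t\in[0,1]$, that is, the given strong deformation retraction takes place during $[0,\tfrac12]$ and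 is stationary thereafter. -/

import Mathlib

open Set Topology unitInterval

universe u v

/-- A metrizable space `V` is an absolute neighbourhood retract if every continuous map into `V`
from a closed subset `C` of a metrizable space `Z` extends to an open neighbourhood of `C`. -/
def IsANR (V : Type u) [TopologicalSpace V] : Prop :=
  TopologicalSpace.MetrizableSpace V ∧
    ∀ (Z : Type u) [TopologicalSpace Z] [TopologicalSpace.MetrizableSpace Z] (C : Set Z),
      IsClosed C → ∀ ψ : C(C, V),
        ∃ (W : Set Z) (hCW : C ⊆ W) (ψ' : C(W, V)),
          IsOpen W ∧ ∀ c : C, ψ' (Set.inclusion hCW c) = ψ c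

/-- An ANR that embeds (topologically) into some Euclidean space. -/
def IsFiniteDimANR (V : Type u) [TopologicalSpace V] : Prop :=
  IsANR V ∧ ∃ (m : ℕ) (e : V → EuclideanSpace ℝ (Fin m)), IsEmbedding e

/-- `(U, A)` is a pair of (finite-dimensional) ANRs: both `U` and the subspace `A` are such. -/
def IsANRPair {U : Type u} [TopologicalSpace U] (A : Set U) : Prop :=
  IsFiniteDimANR U ∧ IsFiniteDimANR A

/-- The continuous map `f` is a homotopy equivalence. -/
def IsHomotopyEquivalence {X : Type u} {Y : Type v} [TopologicalSpace X] [TopologicalSpace Y]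
    (f : C(X, Y)) : Prop :=
  ∃ e : ContinuousMap.HomotopyEquiv X Y, e.toFun = f

/-- The map of pairs `f : (X, A) → (Y, B)` is a homotopy equivalence of pairs: it has an inverse
map of pairs, up to homotopies through maps of pairs. -/
def IsHomotopyEquivalenceOfPairs {X : Type u} {Y : Type v}
    [TopologicalSpace X] [TopologicalSpace Y] (A : Set X) (B : Set Y) (f : C(X, Y)) : Prop :=
  MapsTo f A B ∧ ∃ g : C(Y, X), MapsTo g B A ∧
    (g.comp f).HomotopicWith (ContinuousMap.id X) (fun h => MapsTo h A A) ∧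
    (f.comp g).HomotopicWith (ContinuousMap.id Y) (fun h => MapsTo h B B)

/-- The restriction `A → B` of a map of pairs `(X, A) → (Y, B)`. -/
def restrictPair {X : Type u} {Y : Type v} [TopologicalSpace X] [TopologicalSpace Y]
    {A : Set X} {B : Set Y} (f : C(X, Y)) (h : MapsTo f A B) : C(A, B) :=
  ⟨h.restrict f A B, f.continuous.restrict h⟩

/-- The gluing relation `(x, 0) ∼ f x` on `(X × [0,1]) ⊔ Y`. -/
inductive MappingCylinderRel {X : Type u} {Y : Type v} [TopologicalSpace X] [TopologicalSpace Y]
    (f : C(X, Y)) : (X × I) ⊕ Y → (X × I) ⊕ Y → Prop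
  | glue (x : X) : MappingCylinderRel f (Sum.inl (x, 0)) (Sum.inr (f x))

/-- The mapping cylinder `M(f)`: the quotient of `(X × [0,1]) ⊔ Y` by the equivalence relation
generated by `(x, 0) ∼ f x`. -/
def MappingCylinder {X : Type u} {Y : Type v} [TopologicalSpace X] [TopologicalSpace Y]
    (f : C(X, Y)) : Type (max u v) :=
  Quot (MappingCylinderRel f)

namespace MappingCylinder

variable {X : Type u} {Y : Type v} [TopologicalSpace X] [TopologicalSpace Y]

/-- The quotient topology. -/
instance (f : C(X, Y)) : TopologicalSpace (MappingCylinder f) :=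
  inferInstanceAs (TopologicalSpace (Quot (MappingCylinderRel f)))

/-- The quotient map `(X × [0,1]) ⊔ Y → M(f)`. -/
def mk (f : C(X, Y)) : C((X × I) ⊕ Y, MappingCylinder f) :=
  ⟨Quot.mk (MappingCylinderRel f), continuous_quot_mk⟩

/-- The copy of the domain `X` in `M(f)`, namely (the image of) the free end `X × {1}`. -/
def domainEnd (f : C(X, Y)) : Set (MappingCylinder f) :=
  Set.range fun x : X => mk f (Sum.inl (x, 1))

/-- The canonical map `M(f|_A) → M(f)` for a map of pairs `f : (X, A) → (Y, B)`, induced by the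
inclusions of `A × [0,1]` and `B`. -/
def incl {A : Set X} {B : Set Y} (f : C(X, Y)) (h : MapsTo f A B) :
    C(MappingCylinder (restrictPair f h), MappingCylinder f) where
  toFun := Quot.map (Sum.map (Prod.map Subtype.val id) Subtype.val) (by
    rintro _ _ ⟨a⟩
    exact MappingCylinderRel.glue (a : X))
  continuous_toFun := by
    refine continuous_quot_lift _ (continuous_quot_mk.comp ?_)
    exact (continuous_subtype_val.prodMap continuous_id).sumMap continuous_subtype_val

end MappingCylinder

/-- `ω` is a strong deformation retraction of `X` onto the subset `S`: it starts at the identity,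
ends with values in `S`, and keeps `S` pointwise fixed throughout. -/
structure IsStrongDeformationRetraction {X : Type u} [TopologicalSpace X]
    (S : Set X) (ω : C(I × X, X)) : Prop where
  map_zero : ∀ x, ω (0, x) = x
  map_one_mem : ∀ x, ω (1, x) ∈ S
  fixed : ∀ t, ∀ x ∈ S, ω (t, x) = x

/-- The reparametrization `t ↦ min (2 t) 1` of `[0,1]`. -/
noncomputable def doubleSpeed (t : I) : I :=
  ⟨min (2 * (t : ℝ)) 1, le_min (mul_nonneg zero_le_two t.2.1) zero_le_one, min_le_right _ _⟩

/-! The ANR hypotheses enter only through `IsANR.isNDR`: a closed sub-ANR of an ANR is an NDR. From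
then on the argument is pure homotopy extension, for NDR pairs of arbitrary spaces.

The mapping cylinder of a homotopy equivalence strongly deforms onto its domain end, since that end
is an NDR and a retract whose retraction is homotopic to the identity. Given ω on M(γ|A), homotopy
extension (`IsNDR.exists_homotopy_extension`) first spreads it to a homotopy φ of M(γ) fixing the
domain end. The result φ₁ is then pushed into U by a strong deformation ρ of M(γ). Since φ₁ already
sends the image of M(γ|A) into the domain end, which ρ fixes, nothing moves there in the second
half; this is assertion 2.

For assertion 1, the final map of such an extension θ retracts M(γ) to U and carries the image of
M(γ|A) into A. Its restriction to V is δ. The lines x × [0,1] of the cylinder give δγ ≃ id, and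
projecting θ back to V gives γδ ≃ id, both through maps of pairs. -/

/-- `A` is a neighbourhood deformation retract of `X`: it is the zero set of a function `d`, and
there is a homotopy of `X`, starting at the identity and fixing `A`, that has moved each point `x`
with `d x < 1` into `A` from the time `d x` on. -/
def IsNDR {X : Type u} [TopologicalSpace X] (A : Set X) : Prop :=
  ∃ (d : C(X, I)) (h : C(X × I, X)), (∀ x, d x = 0 ↔ x ∈ A) ∧ (∀ x, h (x, 0) = x) ∧
    (∀ x ∈ A, ∀ t, h (x, t) = x) ∧ ∀ x t, d x ≤ t → d x < 1 → h (x, t) ∈ A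

theorem IsNDR.isClosed {X : Type u} [TopologicalSpace X] {A : Set X} (hA : IsNDR A) :
    IsClosed A := by
  obtain ⟨d, -, hd, -⟩ := hA
  have : A = d ⁻¹' {0} := by ext x; simp [hd]
  rw [this]
  exact isClosed_singleton.preimage d.continuous

/-! ### Closed sub-ANRs of ANRs are NDRs -/

theorem IsANR.exists_continuousOn_extension {V : Type u} [TopologicalSpace V] (hV : IsANR V)
    {Z : Type u} [TopologicalSpace Z] [TopologicalSpace.MetrizableSpace Z] {C : Set Z}
    (hC : IsClosed C) (ψ : Z → V) (hψ : ContinuousOn ψ C) :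
    ∃ W, IsOpen W ∧ C ⊆ W ∧ ∃ ψ' : Z → V, ContinuousOn ψ' W ∧ EqOn ψ' ψ C := by
  classical
  obtain ⟨W, hCW, ψ', hW, h⟩ := hV.2 Z C hC ⟨C.domRestrict ψ, hψ.domRestrict⟩
  refine ⟨W, hW, hCW, fun z => if hz : z ∈ W then ψ' ⟨z, hz⟩ else ψ z, ?_, ?_⟩
  · rw [continuousOn_iff_continuous_domRestrict]
    convert ψ'.continuous using 1
    ext z
    simp
  · intro z hz
    simp only [hCW hz, dif_pos]
    exact h ⟨z, hz⟩

theorem IsANR.exists_neighborhood_retraction {U : Type u} [TopologicalSpace U]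
    [TopologicalSpace.MetrizableSpace U] {A : Set U} (hA : IsClosed A) (hAA : IsANR A) :
    ∃ W, IsOpen W ∧ A ⊆ W ∧ ∃ r : U → U, ContinuousOn r W ∧ (∀ x ∈ W, r x ∈ A) ∧
      ∀ x ∈ A, r x = x := by
  classical
  obtain ⟨W, hAW, r, hW, h⟩ := hAA.2 U A hA (ContinuousMap.id A)
  refine ⟨W, hW, hAW, fun x => if hx : x ∈ W then r ⟨x, hx⟩ else x, ?_, ?_, ?_⟩
  · rw [continuousOn_iff_continuous_domRestrict]
    convert continuous_subtype_val.comp r.continuous using 1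
    ext x
    simp
  · intro x hx
    simp [hx]
  · intro x hx
    simpa [hAW hx] using congrArg Subtype.val (h ⟨x, hx⟩)

theorem exists_continuous_eq_zero_iff {X : Type u} [TopologicalSpace X]
    [TopologicalSpace.MetrizableSpace X] {A : Set X} (hA : IsClosed A) :
    ∃ d : C(X, I), ∀ x, d x = 0 ↔ x ∈ A := by
  let _ := TopologicalSpace.metrizableSpaceMetric X
  rcases A.eq_empty_or_nonempty with rfl | hne
  · exact ⟨ContinuousMap.const X 1, by simp⟩
  · refine ⟨⟨fun x => ⟨min (Metric.infDist x A) 1, le_min Metric.infDist_nonneg zero_le_one,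
      min_le_right _ _⟩, ?_⟩, fun x => ?_⟩
    · exact Continuous.subtype_mk ((Metric.continuous_infDist_pt A).min continuous_const) _
    · have h0 : 0 ≤ Metric.infDist x A := Metric.infDist_nonneg
      rw [hA.mem_iff_infDist_zero hne, ← Subtype.coe_inj]
      simp only [ContinuousMap.coe_mk, Icc.coe_zero]
      constructor
      · intro h
        rcases min_choice (Metric.infDist x A) 1 with h' | h' <;> rw [h'] at h <;> linarith
      · intro h
        simp [h]

/-- A neighbourhood retraction r of A is joined to the identity by extending, over an open subset of
U × I, the map that is the identity on U × {0} ∪ A × I and r on the region d x ≤ t near A. A cutoff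
then makes the homotopy global. -/
theorem IsANR.isNDR {U : Type u} [TopologicalSpace U] (hU : IsANR U) {A : Set U}
    (hA : IsClosed A) (hAA : IsANR A) : IsNDR A := by
  classical
  have := hU.1
  let _ := TopologicalSpace.metrizableSpaceMetric U
  obtain ⟨W, hW, hAW, r, hrc, hrA, hr⟩ := hAA.exists_neighborhood_retraction hA
  obtain ⟨W₁, hW₁, hAW₁, hW₁W⟩ := normal_exists_closure_subset hA hW hAW
  obtain ⟨d, hd⟩ := exists_continuous_eq_zero_iff hA
  have hC₁ : IsClosed {p : U × I | p.2 = 0 ∨ p.1 ∈ A} :=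
    (isClosed_singleton.preimage continuous_snd).union (hA.preimage continuous_fst)
  have hC₂ : IsClosed {p : U × I | d p.1 ≤ p.2 ∧ p.1 ∈ closure W₁} :=
    (isClosed_le (by fun_prop) continuous_snd).inter (isClosed_closure.preimage continuous_fst)
  let ψ : U × I → U := fun p => if p.2 = 0 ∨ p.1 ∈ A then p.1 else r p.1
  have hψ₁ : ∀ p : U × I, p.2 = 0 ∨ p.1 ∈ A → ψ p = p.1 := fun p hp => if_pos hp
  have hψ₂ : ∀ p : U × I, d p.1 ≤ p.2 → ψ p = r p.1 := by
    intro p hp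
    by_cases h : p.2 = 0 ∨ p.1 ∈ A
    · have hpA : p.1 ∈ A := by
        rcases h with h | h
        · exact (hd _).1 (le_antisymm (h ▸ hp) (d p.1).2.1)
        · exact h
      rw [hψ₁ p h, hr _ hpA]
    · exact if_neg h
  have hψ : ContinuousOn ψ ({p : U × I | p.2 = 0 ∨ p.1 ∈ A} ∪
      {p : U × I | d p.1 ≤ p.2 ∧ p.1 ∈ closure W₁}) := by
    refine ContinuousOn.union_of_isClosed ?_ ?_ hC₁ hC₂
    · exact continuousOn_fst.congr hψ₁
    · refine ContinuousOn.congr (f := fun p : U × I => r p.1) ?_ fun p hp => hψ₂ p hp.1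
      exact hrc.comp continuousOn_fst fun p hp => hW₁W hp.2
  obtain ⟨O, hO, hCO, Ψ, hΨc, hΨ⟩ := hU.exists_continuousOn_extension (hC₁.union hC₂) ψ hψ
  -- By compactness of I, the points whose whole segment {x} × I lies in O form an open set.
  have hN : IsOpen ({x : U | ∀ t : I, (x, t) ∈ O} ∩ W₁) := by
    refine IsOpen.inter ?_ hW₁
    rw [isOpen_iff_eventually]
    intro x hx
    have := isCompact_univ.eventually_forall_of_forall_eventually (x₀ := x)
      (P := fun x (t : I) => (x, t) ∈ O) fun t _ => hO.eventually_mem (hx t)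
    filter_upwards [this] with y hy t using hy t (mem_univ t)
  have hAN : A ⊆ {x : U | ∀ t : I, (x, t) ∈ O} ∩ W₁ := fun x hx =>
    ⟨fun t => hCO (Or.inl (Or.inr hx)), hAW₁ hx⟩
  obtain ⟨f, hf0, hf1, -⟩ := exists_continuous_zero_one_of_isClosed hA hN.isClosed_compl
    (disjoint_compl_right_iff_subset.2 hAN)
  -- Since f is 0 on A and 1 off the neighbourhood, l stops the homotopy off it and equals 1 where f
  -- ≤ 1/2, while m is 1 where f ≥ 1/2. Hence max(d, m) < 1 forces l = 1.
  let l : C(U, I) := ⟨fun x => projIcc 0 1 zero_le_one (2 - 2 * f x),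
    continuous_projIcc.comp (by fun_prop)⟩
  let m : C(U, I) := ⟨fun x => projIcc 0 1 zero_le_one (2 * f x),
    continuous_projIcc.comp (by fun_prop)⟩
  have hl : ∀ x t, (x, t * l x) ∈ O := by
    intro x t
    by_cases hx : x ∈ {x : U | ∀ t : I, (x, t) ∈ O} ∩ W₁
    · exact hx.1 _
    · have : l x = 0 := projIcc_of_le_left zero_le_one (by simp [hf1 hx])
      rw [this, mul_zero]
      exact hCO (Or.inl (Or.inl rfl))
  refine ⟨d ⊔ m, ⟨fun p => Ψ (p.1, p.2 * l p.1), ?_⟩, ?_, ?_, ?_, ?_⟩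
  · exact hΨc.comp_continuous (by fun_prop) fun p => hl _ _
  · intro x
    rw [ContinuousMap.sup_apply]
    constructor
    · intro h
      exact (hd x).1 (le_antisymm (h ▸ le_sup_left) (d x).2.1)
    · intro hx
      have hm : m x = 0 := projIcc_of_le_left zero_le_one (by simp [hf0 hx])
      rw [(hd x).2 hx, hm, sup_idem]
  · intro x
    have hx : (x, (0 : I)) ∈ {p : U × I | p.2 = 0 ∨ p.1 ∈ A} := Or.inl rfl
    simp only [ContinuousMap.coe_mk, zero_mul]
    rw [hΨ (Or.inl hx), hψ₁ _ hx]
  · intro x hx t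
    have hx' : (x, t * l x) ∈ {p : U × I | p.2 = 0 ∨ p.1 ∈ A} := Or.inr hx
    simp only [ContinuousMap.coe_mk]
    rw [hΨ (Or.inl hx'), hψ₁ _ hx']
  · intro x t hxt hx1
    rw [ContinuousMap.sup_apply] at hxt hx1
    have hm1 : m x < 1 := lt_of_le_of_lt le_sup_right hx1
    have hfx : 2 * f x < 1 := by
      by_contra hcon
      exact hm1.ne (projIcc_of_right_le zero_le_one (not_lt.1 hcon))
    have hlx : l x = 1 := projIcc_of_right_le zero_le_one (by linarith)
    have hxN : x ∈ {x : U | ∀ t : I, (x, t) ∈ O} ∩ W₁ := by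
      by_contra hcon
      have := hf1 hcon
      simp only [Pi.one_apply] at this
      linarith
    have hdt : d x ≤ t := le_trans le_sup_left hxt
    simp only [ContinuousMap.coe_mk, hlx, mul_one]
    rw [hΨ (Or.inr ⟨hdt, subset_closure hxN.2⟩), hψ₂ _ hdt]
    exact hrA x (hW₁W (subset_closure hxN.2))

/-! ### Homotopy extension and products of NDRs -/

/-- X × I retracts onto X × {0} ∪ A × I: until time d x, follow h at height 0; at time d x the point
has reached A, and the remaining time t - d x is spent climbing. -/
theorem IsNDR.exists_homotopy_extension {X : Type u} [TopologicalSpace X] {A : Set X}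
    (hA : IsNDR A) {Y : Type v} [TopologicalSpace Y] (f : C(X, Y)) (H : X × I → Y)
    (hH : ContinuousOn H (A ×ˢ univ)) (h0 : ∀ x ∈ A, H (x, 0) = f x) :
    ∃ F : C(X × I, Y), (∀ x, F (x, 0) = f x) ∧ ∀ x ∈ A, ∀ t, F (x, t) = H (x, t) := by
  classical
  have hAc := hA.isClosed
  obtain ⟨d, h, hd, hh0, hhA, hh⟩ := hA
  let G : X × I → Y := fun p => if p.2 = 0 then f p.1 else H p
  have hG₀ : ∀ p : X × I, p.2 = 0 → G p = f p.1 := fun p hp => if_pos hp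
  have hG₁ : ∀ p : X × I, p.1 ∈ A → G p = H p := by
    rintro ⟨x, t⟩ hp
    by_cases ht : t = 0
    · subst ht
      rw [hG₀ _ rfl, h0 x hp]
    · exact if_neg ht
  have hG : ContinuousOn G ({p : X × I | p.2 = 0} ∪ A ×ˢ univ) := by
    refine ContinuousOn.union_of_isClosed ?_ ?_ (isClosed_singleton.preimage continuous_snd)
      (hAc.prod isClosed_univ)
    · exact (f.continuous.comp continuous_fst).continuousOn.congr hG₀
    · exact hH.congr fun p hp => hG₁ p hp.1
  let s : C(X × I, I) := ⟨fun p => projIcc 0 1 zero_le_one ((p.2 : ℝ) - d p.1),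
    continuous_projIcc.comp (by fun_prop)⟩
  have hs : ∀ x t, t ≤ d x → s (x, t) = 0 := fun x t hxt =>
    projIcc_of_le_left zero_le_one (sub_nonpos.2 (Subtype.coe_le_coe.2 hxt))
  have hsA : ∀ x t, x ∈ A → s (x, t) = t := by
    intro x t hx
    simp [s, (hd x).2 hx]
  refine ⟨⟨fun p => G (h (p.1, min p.2 (d p.1)), s p), ?_⟩, ?_, ?_⟩
  · refine hG.comp_continuous (by fun_prop) ?_
    rintro ⟨x, t⟩
    rcases le_or_gt t (d x) with hxt | hxt
    · exact Or.inl (hs x t hxt)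
    · refine Or.inr ⟨?_, mem_univ _⟩
      simp only [min_eq_right hxt.le]
      exact hh x _ le_rfl (hxt.trans_le t.2.2)
  · intro x
    have h1 : (0 : I) ≤ d x := (d x).2.1
    simp only [ContinuousMap.coe_mk, min_eq_left h1, hs x 0 h1, hh0]
    exact hG₀ _ rfl
  · intro x hx t
    simp only [ContinuousMap.coe_mk, hhA x hx, hsA x t hx]
    exact hG₁ _ hx

/-- Each factor's homotopy is stopped at the other factor's distance. The nearer factor still
reaches its subspace, and a point already in one subspace leaves the other coordinate at rest. -/
theorem IsNDR.prod {X : Type u} {Y : Type v} [TopologicalSpace X] [TopologicalSpace Y]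
    {A : Set X} {B : Set Y} (hA : IsNDR A) (hB : IsNDR B) :
    IsNDR {p : X × Y | p.1 ∈ A ∨ p.2 ∈ B} := by
  obtain ⟨d, h, hd, hh0, hhA, hh⟩ := hA
  obtain ⟨e, k, he, hk0, hkB, hk⟩ := hB
  have hd0 : ∀ x, 0 ≤ d x := fun x => (d x).2.1
  have he0 : ∀ y, 0 ≤ e y := fun y => (e y).2.1
  refine ⟨⟨fun p => min (d p.1) (e p.2), by fun_prop⟩,
    ⟨fun p => (h (p.1.1, min p.2 (e p.1.2)), k (p.1.2, min p.2 (d p.1.1))), by fun_prop⟩,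
    ?_, ?_, ?_, ?_⟩
  · rintro ⟨x, y⟩
    simp only [ContinuousMap.coe_mk, mem_ofPred_eq, ← hd, ← he]
    constructor
    · intro h
      rcases min_choice (d x) (e y) with h' | h'
      · exact Or.inl (h' ▸ h)
      · exact Or.inr (h' ▸ h)
    · rintro (h | h)
      · rw [h, min_eq_left (he0 y)]
      · rw [h, min_eq_right (hd0 x)]
  · rintro ⟨x, y⟩
    simp [hh0, hk0]
  · rintro ⟨x, y⟩ (hx | hy) t
    · have ht : min t 0 = (0 : I) := min_eq_right t.2.1
      have hx' : d x = 0 := (hd x).2 hx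
      simp only [ContinuousMap.coe_mk, hx', ht, hk0, hhA x hx]
    · have ht : min t 0 = (0 : I) := min_eq_right t.2.1
      have hy' : e y = 0 := (he y).2 hy
      simp only [ContinuousMap.coe_mk, hy', ht, hh0, hkB y hy]
  · rintro ⟨x, y⟩ t hle hlt
    simp only [ContinuousMap.coe_mk] at hle hlt
    rcases le_total (d x) (e y) with hxy | hxy
    · rw [min_eq_left hxy] at hle hlt
      exact Or.inl (hh x _ (le_min hle hxy) hlt)
    · rw [min_eq_right hxy] at hle hlt
      exact Or.inr (hk y _ (le_min hle hxy) hlt)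

/-- Points are pushed away from 1/2; the factor 4 is chosen so that a point within 1/4 of an end
arrives by time d. -/
theorem isNDR_endpoints : IsNDR ({0, 1} : Set I) := by
  refine ⟨⟨fun y => projIcc 0 1 zero_le_one (4 * min (y : ℝ) (1 - y)),
    continuous_projIcc.comp (by fun_prop)⟩,
    ⟨fun p => projIcc 0 1 zero_le_one ((p.1 : ℝ) + (p.1 - 1 / 2) * p.2),
    continuous_projIcc.comp (by fun_prop)⟩, ?_, ?_, ?_, ?_⟩
  · rintro ⟨y, hy0, hy1⟩
    simp only [ContinuousMap.coe_mk, mem_insert_iff, mem_singleton_iff]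
    rw [← Subtype.coe_inj, ← Subtype.coe_inj (b := (0 : I)), ← Subtype.coe_inj (b := (1 : I))]
    refine (Subtype.coe_inj.trans (projIcc_eq_left zero_lt_one)).trans ?_
    simp only [Icc.coe_zero, Icc.coe_one]
    constructor
    · intro h
      rcases min_choice y (1 - y) with h' | h' <;> rw [h'] at h
      · left; linarith
      · right; linarith
    · rintro (rfl | rfl) <;> norm_num
  · intro y
    simp
  · rintro y (rfl | rfl) t
    · exact projIcc_of_le_left zero_le_one (by simp; exact t.2.1)
    · exact projIcc_of_right_le zero_le_one (by have := t.2.1; simp; linarith)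
  · rintro ⟨y, hy0, hy1⟩ ⟨t, ht0, ht1⟩ hle hlt
    simp only [ContinuousMap.coe_mk] at hle hlt ⊢
    have hlt' : 4 * min y (1 - y) < 1 := by
      by_contra hcon
      exact hlt.ne (projIcc_of_right_le zero_le_one (not_lt.1 hcon))
    have hle' : 4 * min y (1 - y) ≤ t := by
      have hmin : 0 ≤ 4 * min y (1 - y) :=
        mul_nonneg (by norm_num) (le_min hy0 (sub_nonneg.2 hy1))
      rw [projIcc_of_mem _ ⟨hmin, hlt'.le⟩] at hle
      exact hle
    rcases le_total y (1 - y) with h | h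
    · rw [min_eq_left h] at hle' hlt'
      exact Or.inl (projIcc_of_le_left zero_le_one (by nlinarith))
    · rw [min_eq_right h] at hle' hlt'
      exact Or.inr (projIcc_of_right_le zero_le_one (by nlinarith))

/-! ### Concatenation and strong deformation retractions -/

/-- The reparametrization `t ↦ max (2 t - 1) 0` of `[0,1]`. -/
noncomputable def delayedDoubleSpeed (t : I) : I :=
  projIcc 0 1 zero_le_one (2 * (t : ℝ) - 1)

theorem continuous_delayedDoubleSpeed : Continuous delayedDoubleSpeed :=
  continuous_projIcc.comp (by fun_prop)

theorem continuous_doubleSpeed : Continuous doubleSpeed :=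
  Continuous.subtype_mk (by fun_prop) _

theorem doubleSpeed_of_half_le {t : I} (ht : 1 / 2 ≤ (t : ℝ)) : doubleSpeed t = 1 :=
  Subtype.ext (min_eq_right (by linarith))

theorem doubleSpeed_zero : doubleSpeed 0 = 0 :=
  Subtype.ext (by simp [doubleSpeed])

theorem doubleSpeed_one : doubleSpeed 1 = 1 :=
  doubleSpeed_of_half_le (by norm_num)

theorem delayedDoubleSpeed_of_le_half {t : I} (ht : (t : ℝ) ≤ 1 / 2) : delayedDoubleSpeed t = 0 :=
  projIcc_of_le_left zero_le_one (by linarith)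

theorem delayedDoubleSpeed_one : delayedDoubleSpeed 1 = 1 :=
  projIcc_of_right_le zero_le_one (by norm_num)

/-- Two consecutive homotopies can be run one after the other. -/
theorem exists_homotopy_concat {X : Type u} {Y : Type v} [TopologicalSpace X] [TopologicalSpace Y]
    (F G : C(I × X, Y)) (h : ∀ x, F (1, x) = G (0, x)) :
    ∃ K : C(I × X, Y), (∀ t : I, (t : ℝ) ≤ 1 / 2 → ∀ x, K (t, x) = F (doubleSpeed t, x)) ∧
      ∀ t : I, 1 / 2 ≤ (t : ℝ) → ∀ x, K (t, x) = G (delayedDoubleSpeed t, x) := by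
  classical
  have hF := continuous_doubleSpeed
  have hG := continuous_delayedDoubleSpeed
  have hglue : ∀ t : I, (t : ℝ) = 1 / 2 → ∀ x,
      F (doubleSpeed t, x) = G (delayedDoubleSpeed t, x) := by
    intro t ht x
    rw [doubleSpeed_of_half_le ht.ge, delayedDoubleSpeed_of_le_half ht.le, h]
  refine ⟨⟨fun p => if (p.1 : ℝ) ≤ 1 / 2 then F (doubleSpeed p.1, p.2)
    else G (delayedDoubleSpeed p.1, p.2), ?_⟩, ?_, ?_⟩
  · exact Continuous.if_le (by fun_prop) (by fun_prop) (by fun_prop) (by fun_prop)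
      fun p hp => hglue p.1 hp p.2
  · intro t ht x
    exact if_pos ht
  · intro t ht x
    rcases ht.eq_or_lt with ht | ht
    · rw [← hglue t ht.symm]
      exact if_pos ht.ge
    · exact if_neg (not_le.2 ht)

/-- An NDR subspace onto which the ambient space retracts by a map homotopic to the identity is a
strong deformation retract. -/
theorem IsNDR.exists_strongDeformationRetraction {X : Type u} [TopologicalSpace X] {S : Set X}
    (hS : IsNDR S) (e : C(X, X)) (heS : ∀ x, e x ∈ S) (he : ∀ x ∈ S, e x = x)
    (h : (ContinuousMap.id X).Homotopic e) :
    ∃ ρ : C(I × X, X), IsStrongDeformationRetraction S ρ := by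
  classical
  obtain ⟨H⟩ := h
  have hH0 : ∀ x, H (0, x) = x := fun x => H.apply_zero x
  have hH1 : ∀ x, H (1, x) = e x := fun x => H.apply_one x
  -- K follows H and then the reverse of H applied to e x. On S, where e x = x, it runs along H and
  -- back along the same path, so it can be contracted there.
  obtain ⟨K, hK, hK'⟩ := exists_homotopy_concat (H : C(I × X, X))
    ⟨fun p => H (σ p.1, e p.2), by fun_prop⟩ (fun x => by simp [hH1, he _ (heS x)])
  have hK0 : ∀ x, K (0, x) = x := by
    intro x
    rw [hK 0 (by norm_num), doubleSpeed_zero]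
    exact hH0 x
  have hK1 : ∀ x, K (1, x) = e x := by
    intro x
    rw [hK' 1 (by norm_num), delayedDoubleSpeed_one]
    simp [hH0]
  let m : C(I, I) := ⟨fun t => min (doubleSpeed t) (σ (delayedDoubleSpeed t)),
    continuous_doubleSpeed.min (continuous_symm.comp continuous_delayedDoubleSpeed)⟩
  have hm0 : m 0 = 0 := by
    simp only [m, ContinuousMap.coe_mk, doubleSpeed_zero]
    exact min_eq_left (σ (delayedDoubleSpeed 0)).2.1
  have hm1 : m 1 = 0 := by
    simp only [m, ContinuousMap.coe_mk, delayedDoubleSpeed_one, symm_one]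
    exact min_eq_right (doubleSpeed 1).2.1
  have hKm : ∀ x ∈ S, ∀ t, K (t, x) = H (m t, x) := by
    intro x hx t
    rcases le_total (t : ℝ) (1 / 2) with ht | ht
    · rw [hK t ht]
      simp only [m, ContinuousMap.coe_mk, delayedDoubleSpeed_of_le_half ht, symm_zero]
      rw [min_eq_left (show doubleSpeed t ≤ 1 from (doubleSpeed t).2.2)]
    · rw [hK' t ht]
      simp only [m, ContinuousMap.coe_mk, doubleSpeed_of_half_le ht, he x hx]
      rw [min_eq_right (show σ (delayedDoubleSpeed t) ≤ 1 from (σ (delayedDoubleSpeed t)).2.2)]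
  -- As s grows, the there-and-back path over S shrinks to the constant path, while K is kept at
  -- times 0 and 1. Extending this to X × I, the level s = 1 is the required deformation.
  let G : (X × I) × I → X := fun q =>
    if q.1.2 = 0 ∨ q.1.2 = 1 then K (q.1.2, q.1.1) else H (m q.1.2 * σ q.2, q.1.1)
  have hG₁ : ∀ q : (X × I) × I, q.1.2 = 0 ∨ q.1.2 = 1 → G q = K (q.1.2, q.1.1) :=
    fun q hq => if_pos hq
  have hG₂ : ∀ q : (X × I) × I, q.1.1 ∈ S → G q = H (m q.1.2 * σ q.2, q.1.1) := by
    rintro ⟨⟨x, t⟩, s⟩ hx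
    by_cases ht : t = 0 ∨ t = 1
    · rw [hG₁ _ ht]
      rcases ht with rfl | rfl
      · simp [hm0, hK0, hH0]
      · simp only [hK1, hm1, zero_mul, hH0]
        exact he x hx
    · exact if_neg ht
  have hE : IsClosed {q : (X × I) × I | q.1.2 = 0 ∨ q.1.2 = 1} :=
    (isClosed_singleton.preimage (by fun_prop : Continuous fun q : (X × I) × I => q.1.2)).union
      (isClosed_singleton.preimage (by fun_prop : Continuous fun q : (X × I) × I => q.1.2))
  have hES : IsClosed {q : (X × I) × I | q.1.1 ∈ S} := hS.isClosed.preimage (by fun_prop)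
  have hGc : ContinuousOn G ({p : X × I | p.1 ∈ S ∨ p.2 ∈ ({0, 1} : Set I)} ×ˢ univ) := by
    refine ContinuousOn.mono (s := {q : (X × I) × I | q.1.2 = 0 ∨ q.1.2 = 1} ∪
      {q : (X × I) × I | q.1.1 ∈ S}) (ContinuousOn.union_of_isClosed ?_ ?_ hE hES) ?_
    · exact ContinuousOn.congr (f := fun q : (X × I) × I => K (q.1.2, q.1.1))
        (by fun_prop) fun q hq => hG₁ q hq
    · exact ContinuousOn.congr (f := fun q : (X × I) × I => H (m q.1.2 * σ q.2, q.1.1))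
        (by fun_prop) fun q hq => hG₂ q hq
    · rintro q ⟨hq | hq, -⟩
      · exact Or.inr hq
      · exact Or.inl hq
  obtain ⟨L, -, hL⟩ := (hS.prod isNDR_endpoints).exists_homotopy_extension
    (K.comp ⟨Prod.swap, continuous_swap⟩) G hGc (by
      rintro ⟨x, t⟩ (hx | ht)
      · rw [hG₂ _ hx]
        simp [hKm x hx]
      · rw [hG₁ ((x, t), 0) ht]
        rfl)
  refine ⟨⟨fun p => L ((p.2, p.1), 1), by fun_prop⟩, ?_, ?_, ?_⟩
  · intro x
    simp only [ContinuousMap.coe_mk]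
    rw [hL (x, 0) (Or.inr (Or.inl rfl)), hG₁ _ (Or.inl rfl), hK0]
  · intro x
    simp only [ContinuousMap.coe_mk]
    rw [hL (x, 1) (Or.inr (Or.inr rfl)), hG₁ _ (Or.inr rfl), hK1]
    exact heS x
  · intro t x hx
    simp only [ContinuousMap.coe_mk]
    rw [hL (x, t) (Or.inl hx), hG₂ _ hx]
    simp [hH0]

/-! ### Mapping cylinders and their domain ends -/

namespace MappingCylinder

variable {X : Type u} {Y : Type v} [TopologicalSpace X] [TopologicalSpace Y]

theorem mk_inl_zero (f : C(X, Y)) (x : X) : mk f (Sum.inl (x, 0)) = mk f (Sum.inr (f x)) :=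
  Quot.sound (.glue x)

theorem ind {f : C(X, Y)} {P : MappingCylinder f → Prop} (hl : ∀ x s, P (mk f (Sum.inl (x, s))))
    (hr : ∀ y, P (mk f (Sum.inr y))) (m : MappingCylinder f) : P m := by
  induction m using Quot.ind with
  | mk p =>
    rcases p with ⟨x, s⟩ | y
    · exact hl x s
    · exact hr y

/-- Maps out of the mapping cylinder. -/
theorem exists_lift {Z : Type*} [TopologicalSpace Z] (f : C(X, Y)) (P : C(X × I, Z)) (Q : C(Y, Z))
    (h : ∀ x, P (x, 0) = Q (f x)) :
    ∃ R : C(MappingCylinder f, Z), (∀ x s, R (mk f (Sum.inl (x, s))) = P (x, s)) ∧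
      ∀ y, R (mk f (Sum.inr y)) = Q y := by
  have hR : ∀ p q, MappingCylinderRel f p q → Sum.elim P Q p = Sum.elim P Q q := by
    rintro _ _ ⟨x⟩
    exact h x
  exact ⟨⟨Quot.lift (Sum.elim P Q) hR, continuous_quot_lift hR
    (P.continuous.sumElim Q.continuous)⟩, fun _ _ => rfl, fun _ => rfl⟩

/-- Homotopies of maps out of the mapping cylinder. -/
theorem exists_homotopy_lift {Z : Type*} [TopologicalSpace Z] (f : C(X, Y))
    (P : C((X × I) × I, Z)) (Q : C(Y × I, Z)) (h : ∀ x t, P ((x, 0), t) = Q (f x, t)) :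
    ∃ R : C(I × MappingCylinder f, Z),
      (∀ t x s, R (t, mk f (Sum.inl (x, s))) = P ((x, s), t)) ∧
      ∀ t y, R (t, mk f (Sum.inr y)) = Q (y, t) := by
  -- Currying the time variable reduces this to a map out of the quotient, so no product of a
  -- quotient map with I is needed.
  obtain ⟨R, hP, hQ⟩ := exists_lift f P.curry Q.curry fun x => by ext t; exact h x t
  refine ⟨R.uncurry.comp ⟨Prod.swap, continuous_swap⟩, fun t x s => ?_, fun t y => ?_⟩
  · exact congrArg (· t) (hP x s)
  · exact congrArg (· t) (hQ y)

/-- The cylinder coordinate s is stretched to s(1 + 2t), cut off at 1, which fixes both s = 0 and s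
= 1 and brings a collar of the end onto it. -/
theorem isNDR_domainEnd (f : C(X, Y)) : IsNDR (domainEnd f) := by
  obtain ⟨d, hd, hd'⟩ := exists_lift f
    ⟨fun p => projIcc 0 1 zero_le_one (2 * (1 - (p.2 : ℝ))),
      continuous_projIcc.comp (by fun_prop)⟩ (ContinuousMap.const Y 1) fun x =>
      projIcc_of_right_le zero_le_one (by norm_num)
  obtain ⟨h, hh, hh'⟩ := exists_homotopy_lift f (Z := MappingCylinder f)
    ⟨fun q => mk f (Sum.inl (q.1.1, projIcc 0 1 zero_le_one ((q.1.2 : ℝ) * (1 + 2 * q.2)))),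
      (mk f).continuous.comp (continuous_inl.comp (Continuous.prodMk (by fun_prop)
        (continuous_projIcc.comp (by fun_prop))))⟩
    ⟨fun q => mk f (Sum.inr q.1), by fun_prop⟩ fun x t => by simp [mk_inl_zero]
  refine ⟨d, h.comp ⟨Prod.swap, continuous_swap⟩, ?_, ?_, ?_, ?_⟩
  · refine ind (fun x s => ?_) fun y => ?_
    · rw [hd]
      constructor
      · intro hs
        have hs' : 2 * (1 - (s : ℝ)) ≤ 0 := (projIcc_eq_left zero_lt_one).1 hs
        have : s = 1 := Subtype.ext (le_antisymm s.2.2 (by rw [Icc.coe_one]; linarith))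
        exact ⟨x, by rw [this]⟩
      · rintro ⟨x', hx'⟩
        rw [← hd, ← hx', hd]
        exact projIcc_of_le_left zero_le_one (by norm_num)
    · rw [hd']
      constructor
      · intro h
        exact absurd h one_ne_zero
      · rintro ⟨x', hx'⟩
        rw [← hd', ← hx', hd]
        exact projIcc_of_le_left zero_le_one (by norm_num)
  · refine ind (fun x s => ?_) fun y => ?_
    · exact (hh 0 x s).trans (by simp)
    · exact hh' 0 y
  · rintro _ ⟨x, rfl⟩ t
    refine (hh t x 1).trans ?_
    have : projIcc 0 1 zero_le_one (((1 : I) : ℝ) * (1 + 2 * t)) = 1 :=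
      projIcc_of_right_le zero_le_one (by have := t.2.1; rw [Icc.coe_one]; linarith)
    simp only [ContinuousMap.coe_mk, this]
  · refine ind (fun x s t hle hlt => ?_) fun y t hle hlt => ?_
    · rw [hd] at hle hlt
      refine ⟨x, ((hh t x s).trans ?_).symm⟩
      have hlt' : 2 * (1 - (s : ℝ)) < 1 := by
        by_contra hcon
        exact hlt.ne (projIcc_of_right_le zero_le_one (not_lt.1 hcon))
      have hle' : 2 * (1 - (s : ℝ)) ≤ t := by
        have hmin : 0 ≤ 2 * (1 - (s : ℝ)) := by have := s.2.2; linarith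
        simp only [ContinuousMap.coe_mk] at hle
        rw [projIcc_of_mem _ ⟨hmin, hlt'.le⟩] at hle
        exact hle
      have : projIcc 0 1 zero_le_one ((s : ℝ) * (1 + 2 * t)) = 1 :=
        projIcc_of_right_le zero_le_one (by have := s.2.2; nlinarith)
      simp only [ContinuousMap.coe_mk, this]
    · rw [hd'] at hlt
      exact absurd hlt (lt_irrefl _)

/-- The mapping cylinder of a homotopy equivalence `f` retracts onto its domain end, by a map that
restricts on the codomain to a homotopy inverse of `f`. -/
theorem exists_retraction {f : C(X, Y)} (hf : IsHomotopyEquivalence f) :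
    ∃ g : C(MappingCylinder f, X), (∀ x, g (mk f (Sum.inl (x, 1))) = x) ∧
      ∃ k : C(Y, X), (∀ y, g (mk f (Sum.inr y)) = k y) ∧
        (f.comp k).Homotopic (ContinuousMap.id Y) := by
  obtain ⟨e, rfl⟩ := hf
  obtain ⟨H⟩ := e.left_inv
  obtain ⟨g, hg, hg'⟩ := exists_lift e.toFun
    (H.toContinuousMap.comp ⟨Prod.swap, continuous_swap⟩) e.invFun fun x => H.apply_zero x
  exact ⟨g, fun x => (hg x 1).trans (H.apply_one x), e.invFun, hg', e.right_inv⟩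

theorem exists_projection (f : C(X, Y)) :
    ∃ π : C(MappingCylinder f, Y), (∀ x s, π (mk f (Sum.inl (x, s))) = f x) ∧
      ∀ y, π (mk f (Sum.inr y)) = y :=
  exists_lift f (f.comp ⟨Prod.fst, continuous_fst⟩) (ContinuousMap.id Y) fun _ => rfl

/-- The mapping cylinder of a homotopy equivalence strongly deformation retracts onto its domain
end. -/
theorem exists_strongDeformationRetraction {f : C(X, Y)} (hf : IsHomotopyEquivalence f) :
    ∃ ρ : C(I × MappingCylinder f, MappingCylinder f),
      IsStrongDeformationRetraction (domainEnd f) ρ := by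
  obtain ⟨g, hg, k, hgk, hk⟩ := exists_retraction hf
  obtain ⟨π, hπ, hπ'⟩ := exists_projection f
  let j : C(X, MappingCylinder f) := ⟨fun x => mk f (Sum.inl (x, 1)), by fun_prop⟩
  let ι : C(Y, MappingCylinder f) := ⟨fun y => mk f (Sum.inr y), by fun_prop⟩
  have hιπ : (ι.comp π).Homotopic (ContinuousMap.id _) := by
    obtain ⟨R, hR, hR'⟩ := exists_homotopy_lift f (Z := MappingCylinder f)
      ⟨fun q => mk f (Sum.inl (q.1.1, q.2 * q.1.2)), by fun_prop⟩
      ⟨fun q => mk f (Sum.inr q.1), by fun_prop⟩ fun x t => by simp [mk_inl_zero]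
    refine ⟨⟨R, ?_, ?_⟩⟩
    · refine ind (fun x s => (hR 0 x s).trans ?_) fun y => (hR' 0 y).trans ?_
      · simp [ι, hπ, mk_inl_zero]
      · simp [ι, hπ']
    · refine ind (fun x s => (hR 1 x s).trans ?_) fun y => (hR' 1 y).trans ?_ <;> simp
  -- With πj = f and gι = k: jg ≃ ιπ·jg·ιπ = ι(fk)π ≃ ιπ ≃ id.
  have hjg : (j.comp g).Homotopic (ContinuousMap.id _) := by
    have h₁ : (j.comp g).Homotopic ((j.comp g).comp (ι.comp π)) :=
      (ContinuousMap.Homotopic.refl (j.comp g)).comp hιπ.symm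
    have h₂ : ((j.comp g).comp (ι.comp π)).Homotopic
        ((ι.comp π).comp ((j.comp g).comp (ι.comp π))) :=
      hιπ.symm.comp (ContinuousMap.Homotopic.refl ((j.comp g).comp (ι.comp π)))
    have h₃ : (ι.comp π).comp ((j.comp g).comp (ι.comp π)) =
        ι.comp ((f.comp k).comp π) := by
      ext m
      simp [ι, j, hπ, hgk]
    have h₄ : (ι.comp ((f.comp k).comp π)).Homotopic (ι.comp π) :=
      (ContinuousMap.Homotopic.refl ι).comp (hk.comp (ContinuousMap.Homotopic.refl π))
    exact h₁.trans (h₂.trans ((h₃ ▸ h₄).trans hιπ))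
  refine (isNDR_domainEnd f).exists_strongDeformationRetraction (j.comp g)
    (fun m => ⟨g m, rfl⟩) ?_ hjg.symm
  rintro _ ⟨x, rfl⟩
  exact congrArg j (hg x)

end MappingCylinder

/-! ### Extending deformations from M(f|A) to M(f) -/

namespace MappingCylinder

variable {X : Type u} {Y : Type v} [TopologicalSpace X] [TopologicalSpace Y]

/-- For closed NDR pairs, a homotopy of `M(f|_A)` that fixes the domain end extends to a homotopy of
`M(f)` that fixes the domain end. -/
theorem exists_homotopy_extension {A : Set X} {B : Set Y} (hA : IsNDR A) (hB : IsNDR B)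
    (f : C(X, Y)) (hf : MapsTo f A B)
    (ω : C(I × MappingCylinder (restrictPair f hf), MappingCylinder (restrictPair f hf)))
    (hω₀ : ∀ z, ω (0, z) = z) (hω : ∀ t, ∀ z ∈ domainEnd (restrictPair f hf), ω (t, z) = z) :
    ∃ θ : C(I × MappingCylinder f, MappingCylinder f), (∀ m, θ (0, m) = m) ∧
      (∀ t, ∀ m ∈ domainEnd f, θ (t, m) = m) ∧
      ∀ t z, θ (t, incl f hf z) = incl f hf (ω (t, z)) := by
  classical
  let g := restrictPair f hf
  -- The extension is made upstairs, first on Y and then on X × I, so `incl` need not be an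
  -- embedding.
  obtain ⟨Q, hQ₀, hQ⟩ := hB.exists_homotopy_extension (Y := MappingCylinder f)
    ⟨fun y => mk f (Sum.inr y), by fun_prop⟩
    (fun q => if h : q.1 ∈ B then incl f hf (ω (q.2, mk g (Sum.inr ⟨q.1, h⟩)))
      else mk f (Sum.inr q.1)) (by
      rw [continuousOn_iff_continuous_domRestrict]
      have : Continuous fun q : (B ×ˢ (univ : Set I) : Set (Y × I)) =>
          incl f hf (ω (q.1.2, mk g (Sum.inr ⟨q.1.1, q.2.1⟩))) := by fun_prop
      convert this using 1
      ext q
      simp [q.2.1]) (by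
      intro y hy
      simp only [hy, dif_pos, hω₀]
      rfl)
  let G₀ : (X × I) × I → MappingCylinder f := fun q =>
    if h : q.1.1 ∈ A then incl f hf (ω (q.2, mk g (Sum.inl (⟨q.1.1, h⟩, q.1.2)))) else
      mk f (Sum.inl q.1)
  -- On X × I the homotopy is prescribed by Q at s = 0, as constant at s = 1 and by ω over A; these
  -- agree because ω fixes the domain end.
  let G : (X × I) × I → MappingCylinder f := fun q =>
    if q.1.2 = 0 then Q (f q.1.1, q.2) else if q.1.2 = 1 then mk f (Sum.inl q.1) else G₀ q
  have hG₁ : ∀ q : (X × I) × I, q.1.2 = 0 → G q = Q (f q.1.1, q.2) := fun q hq => if_pos hq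
  have hG₂ : ∀ q : (X × I) × I, q.1.2 = 1 → G q = mk f (Sum.inl q.1) := by
    intro q hq
    have : q.1.2 ≠ 0 := by rw [hq]; exact one_ne_zero
    simp only [G, if_neg this, if_pos hq]
  have hG₃ : ∀ (q : (X × I) × I) (h : q.1.1 ∈ A),
      G q = incl f hf (ω (q.2, mk g (Sum.inl (⟨q.1.1, h⟩, q.1.2)))) := by
    rintro ⟨⟨x, s⟩, t⟩ hx
    by_cases hs₀ : s = 0
    · subst hs₀
      rw [hG₁ _ rfl, hQ _ (hf hx), mk_inl_zero]
      simp only [dif_pos (hf hx)]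
      rfl
    · by_cases hs₁ : s = 1
      · subst hs₁
        rw [hG₂ _ rfl, hω t _ ⟨⟨x, hx⟩, rfl⟩]
        rfl
      · simp only [G, G₀, if_neg hs₀, if_neg hs₁]
        exact dif_pos hx
  have hc₀ : Continuous fun q : (X × I) × I => q.1.2 := by fun_prop
  have hc₁ : Continuous fun q : (X × I) × I => q.1.1 := by fun_prop
  have hGc : ContinuousOn G ({p : X × I | p.1 ∈ A ∨ p.2 ∈ ({0, 1} : Set I)} ×ˢ univ) := by
    refine ContinuousOn.mono (s := {q : (X × I) × I | q.1.1 ∈ A} ∪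
      ({q : (X × I) × I | q.1.2 = 0} ∪ {q : (X × I) × I | q.1.2 = 1}))
      (ContinuousOn.union_of_isClosed ?_ (ContinuousOn.union_of_isClosed ?_ ?_
        (isClosed_singleton.preimage hc₀) (isClosed_singleton.preimage hc₀))
        (hA.isClosed.preimage hc₁) ((isClosed_singleton.preimage hc₀).union
        (isClosed_singleton.preimage hc₀))) ?_
    · rw [continuousOn_iff_continuous_domRestrict]
      have : Continuous fun q : {q : (X × I) × I | q.1.1 ∈ A} =>
          incl f hf (ω (q.1.2, mk g (Sum.inl (⟨q.1.1.1, q.2⟩, q.1.1.2)))) := by fun_prop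
      convert this using 1
      ext q
      exact hG₃ q.1 q.2
    · exact ContinuousOn.congr (f := fun q : (X × I) × I => Q (f q.1.1, q.2)) (by fun_prop) hG₁
    · exact ContinuousOn.congr (f := fun q : (X × I) × I => mk f (Sum.inl q.1)) (by fun_prop) hG₂
    · rintro q ⟨hq, -⟩
      exact hq
  obtain ⟨P, hP₀, hP⟩ := (hA.prod isNDR_endpoints).exists_homotopy_extension
    ⟨fun p => mk f (Sum.inl p), by fun_prop⟩ G hGc (by
      rintro ⟨x, s⟩ (hx | hs | hs)
      · rw [hG₃ _ hx, hω₀]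
        rfl
      · rw [hG₁ ((x, s), 0) hs, hQ₀, show s = 0 from hs]
        exact (mk_inl_zero f x).symm
      · rw [hG₂ ((x, s), 0) hs]
        rfl)
  obtain ⟨θ, hθ, hθ'⟩ := exists_homotopy_lift f P Q fun x t => by
    rw [hP _ (Or.inr (Or.inl rfl)), hG₁ _ rfl]
  refine ⟨θ, ind (fun x s => ?_) fun y => ?_, ?_, fun t => ind (fun x s => ?_) fun y => ?_⟩
  · rw [hθ, hP₀]
    rfl
  · rw [hθ', hQ₀]
    rfl
  · rintro t _ ⟨x, rfl⟩
    refine (hθ t x 1).trans ?_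
    rw [hP (x, 1) (Or.inr (Or.inr rfl)), hG₂ _ rfl]
  · refine (hθ t x s).trans ?_
    rw [hP _ (Or.inl x.2), hG₃ _ x.2]
  · refine (hθ' t y).trans ?_
    rw [hQ _ y.2]
    exact dif_pos y.2

theorem incl_mem_domainEnd {A : Set X} {B : Set Y} (f : C(X, Y)) (hf : MapsTo f A B)
    {z : MappingCylinder (restrictPair f hf)} (hz : z ∈ domainEnd (restrictPair f hf)) :
    ∃ a ∈ A, incl f hf z = mk f (Sum.inl (a, 1)) := by
  obtain ⟨a, rfl⟩ := hz
  exact ⟨a, a.2, rfl⟩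

/-- For closed NDR pairs, a strong deformation retraction of `M(f|_A)` onto its domain end extends,
after reparametrization, to `M(f)` if `f` is a homotopy equivalence. -/
theorem exists_strongDeformationRetraction_extension {A : Set X} {B : Set Y} (hA : IsNDR A)
    (hB : IsNDR B) {f : C(X, Y)} (hf : MapsTo f A B) (hfe : IsHomotopyEquivalence f)
    {ω : C(I × MappingCylinder (restrictPair f hf), MappingCylinder (restrictPair f hf))}
    (hω : IsStrongDeformationRetraction (domainEnd (restrictPair f hf)) ω) :
    ∃ θ : C(I × MappingCylinder f, MappingCylinder f),
      IsStrongDeformationRetraction (domainEnd f) θ ∧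
      ∀ t z, θ (t, incl f hf z) = incl f hf (ω (doubleSpeed t, z)) := by
  obtain ⟨φ, hφ₀, hφ, hφω⟩ := exists_homotopy_extension hA hB f hf ω hω.map_zero hω.fixed
  obtain ⟨ρ, hρ⟩ := exists_strongDeformationRetraction hfe
  obtain ⟨θ, hθ, hθ'⟩ := exists_homotopy_concat φ ⟨fun p => ρ (p.1, φ (1, p.2)), by fun_prop⟩
    fun m => (hρ.map_zero _).symm
  refine ⟨θ, ⟨fun m => ?_, fun m => ?_, fun t m hm => ?_⟩, fun t z => ?_⟩
  · rw [hθ 0 (by norm_num), doubleSpeed_zero, hφ₀]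
  · rw [hθ' 1 (by norm_num), delayedDoubleSpeed_one]
    exact hρ.map_one_mem _
  · rcases le_total (t : ℝ) (1 / 2) with ht | ht
    · rw [hθ t ht, hφ _ _ hm]
    · rw [hθ' t ht]
      simp only [ContinuousMap.coe_mk]
      rw [hφ _ _ hm, hρ.fixed _ _ hm]
  · rcases le_total (t : ℝ) (1 / 2) with ht | ht
    · rw [hθ t ht, hφω]
    · rw [hθ' t ht, doubleSpeed_of_half_le ht]
      simp only [ContinuousMap.coe_mk]
      rw [hφω]
      obtain ⟨a, -, ha⟩ := incl_mem_domainEnd f hf (hω.map_one_mem z)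
      exact hρ.fixed _ _ ⟨a, ha.symm⟩

end MappingCylinder

/-! ### Homotopy equivalence of pairs -/

open MappingCylinder in
/-- A map of closed NDR pairs both of whose components are homotopy equivalences is a homotopy
equivalence of pairs. -/
theorem isHomotopyEquivalenceOfPairs_of_isNDR {X : Type u} {Y : Type v} [TopologicalSpace X]
    [TopologicalSpace Y] {A : Set X} {B : Set Y} (hA : IsNDR A) (hB : IsNDR B) {f : C(X, Y)}
    (hf : MapsTo f A B) (hfe : IsHomotopyEquivalence f)
    (hfAe : IsHomotopyEquivalence (restrictPair f hf)) :
    IsHomotopyEquivalenceOfPairs A B f := by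
  obtain ⟨ω, hω⟩ := exists_strongDeformationRetraction hfAe
  obtain ⟨θ, hθ, hθω⟩ := exists_strongDeformationRetraction_extension hA hB hf hfe hω
  obtain ⟨g, hg, -⟩ := exists_retraction hfe
  obtain ⟨π, hπ, hπ'⟩ := exists_projection f
  have hgA : ∀ z, g (θ (1, incl f hf z)) ∈ A := by
    intro z
    rw [hθω, doubleSpeed_one]
    obtain ⟨a, ha, haz⟩ := incl_mem_domainEnd f hf (hω.map_one_mem z)
    rw [haz, hg]
    exact ha
  have hπB : ∀ z, π (incl f hf z) ∈ B := by
    refine ind (fun x s => ?_) fun y => ?_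
    · exact (hπ x s).symm ▸ hf x.2
    · exact (hπ' y).symm ▸ y.2
  refine ⟨hf, ⟨fun y => g (θ (1, mk f (Sum.inr y))), by fun_prop⟩, ?_, ⟨⟨⟨⟨fun p =>
    g (θ (1, mk f (Sum.inl (p.2, p.1)))), by fun_prop⟩, ?_, ?_⟩, ?_⟩⟩, ⟨⟨⟨⟨fun p =>
    π (θ (σ p.1, mk f (Sum.inr p.2))), by fun_prop⟩, ?_, ?_⟩, ?_⟩⟩⟩
  · intro y hy
    exact hgA (mk _ (Sum.inr ⟨y, hy⟩))
  · intro x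
    simp [mk_inl_zero]
  · intro x
    simp only [ContinuousMap.id_apply]
    rw [hθ.fixed _ _ ⟨x, rfl⟩, hg]
  · intro t x hx
    exact hgA (mk _ (Sum.inl (⟨x, hx⟩, t)))
  · intro y
    obtain ⟨x, hx⟩ := hθ.map_one_mem (mk f (Sum.inr y))
    simp only [ContinuousMap.coe_mk, ContinuousMap.comp_apply, symm_zero]
    rw [← hx, hπ, hg]
  · intro y
    simp [hθ.map_zero, hπ']
  · intro t y hy
    have := hθω (σ t) (mk _ (Sum.inr ⟨y, hy⟩))
    change π (θ (σ t, incl f hf (mk _ (Sum.inr ⟨y, hy⟩)))) ∈ B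
    rw [this]
    exact hπB _

theorem mainTheorem5 {U : Type u} {V : Type v} [TopologicalSpace U] [TopologicalSpace V]
    (A : Set U) (B : Set V) (hUA : IsANRPair A) (hVB : IsANRPair B)
    (hA : IsClosed A) (hB : IsClosed B)
    (γ : C(U, V)) (hγ : MapsTo γ A B)
    (hγe : IsHomotopyEquivalence γ)
    (hγAe : IsHomotopyEquivalence (restrictPair γ hγ)) :
    IsHomotopyEquivalenceOfPairs A B γ ∧
    ∀ ω : C(I × MappingCylinder (restrictPair γ hγ), MappingCylinder (restrictPair γ hγ)),
      IsStrongDeformationRetraction (MappingCylinder.domainEnd (restrictPair γ hγ)) ω →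
      ∃ θ : C(I × MappingCylinder γ, MappingCylinder γ),
        IsStrongDeformationRetraction (MappingCylinder.domainEnd γ) θ ∧
        ∀ (t : I) (z : MappingCylinder (restrictPair γ hγ)),
          θ (t, MappingCylinder.incl γ hγ z) = MappingCylinder.incl γ hγ (ω (doubleSpeed t, z)) := by
  have hA' := hUA.1.1.isNDR hA hUA.2.1
  have hB' := hVB.1.1.isNDR hB hVB.2.1
  exact ⟨isHomotopyEquivalenceOfPairs_of_isNDR hA' hB' hγ hγe hγAe, fun _ hω =>
    MappingCylinder.exists_strongDeformationRetraction_extension hA' hB' hγ hγe hω⟩
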